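/- For an integer $K\ge 1$ let $\mathbb{T}_K=\mathbb{Z}/K\mathbb{Z}$ and $\Gamma_K=\{n\in\mathbb{Z}: n\le 1\}^{\mathbb{T}_K}$. In a configuration $\xi\in\Gamma_K$, $\xi_k=1$ means that site $k$ holds a particle, $\xi_k=0$ that it is empty, and $\xi_k<0$ that it is a trap of depth $|\xi_k|$. The symmetric simple exclusion process with traps (SWT) is the continuous-time Markov process $(\xi(t))_{t\ge 0}$ on $\Gamma_K$ with generator $$\mathscr{L}_K f(\xi)=\sum_{k\in\mathbb{T}_K}\sum_{z=\pm1}\mathbf 1_{\{\xi_k=1,\ \xi_{k+z}\le 0\}}\bigl(f(\xi^{k,k+z})-f(\xi)\bigr),$$ where $\xi^{k,k+z}$ is obtained from $\xi$ by setting the value at $k$ to $0$ and increasing the value at $k+z$ by $1$. Let $\mathbf P^K_\xi$ be its law when started from $\xi$. A configuration is transient if it has at least one particle and at least one trap of positive depth; let $\mathcal{T}_K$ be the set of transient configurations, and set $$p_K(t)=\sup_{\xi\in\Gamma_K}\mathbf P^K_\xi\bigl(\xi(t)\in\mathcal{T}_K\bigr),\qquad t\ge 0.$$ Then $$\lim_{t\to+\infty}\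 \sup_{K\ge 1}\ p_K\bigl(tK^2\log K\bigr)=0.$$ -/

import Mathlib

open Filter Topology MeasureTheory ProbabilityTheory
open scoped ENNReal

noncomputable section

namespace SWT

/-- Configurations of the SSEP with traps on the ring of `K` sites: `1` is a particle, `0` an empty
site, and `-d < 0` a trap of depth `d`. -/
abbrev Conf (K : ℕ) : Type := {ξ : ZMod K → ℤ // ∀ k, ξ k ≤ 1}

variable {K : ℕ}

/-- A particle sits at `k` and `l` is empty or a trap, so that the particle may jump to `l`. -/
abbrev CanJump (ξ : Conf K) (k l : ZMod K) : Prop := ξ.1 k = 1 ∧ ξ.1 l ≤ 0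

/-- The configuration `ξ^{k,l}` after the particle at `k` has jumped to `l`. -/
def jump (ξ : Conf K) (k l : ZMod K) (h : CanJump ξ k l) : Conf K :=
  ⟨fun j => if j = k then 0 else if j = l then ξ.1 l + 1 else ξ.1 j, fun j => by
    have h1 := ξ.2 j
    have h2 := h.2
    dsimp only
    split_ifs <;> omega⟩

/-- The generator of the SSEP with traps:
`(L f)(ξ) = ∑_k ∑_{z = ±1} 1{ξ_k = 1, ξ_{k+z} ≤ 0} (f(ξ^{k,k+z}) - f(ξ))`. -/
def generator [NeZero K] (f : Conf K → ℝ) (ξ : Conf K) : ℝ :=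
  ∑ k : ZMod K, ∑ z ∈ ({1, -1} : Finset ℤ),
    if h : CanJump ξ k (k + z) then f (jump ξ k (k + z) h) - f ξ else 0

/-- The set of transient configurations: there is at least one trap of positive depth and at least
one particle. -/
def transient (K : ℕ) : Set (Conf K) := {ξ | (∃ k, ξ.1 k < 0) ∧ ∃ k, ξ.1 k = 1}

/-- The effect of a ring of the clock of the edge `(k, k + 1)`: the jump over this edge that is
allowed, if there is one, is performed. -/
def flip (ξ : Conf K) (k : ZMod K) : Conf K :=
  if h : CanJump ξ k (k + 1) then jump ξ k (k + 1) h
  else if h : CanJump ξ (k + 1) k then jump ξ (k + 1) k h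
  else ξ

/-- The successive rings of `K` independent Poisson clocks of rate `1`, one for each edge
`(k, k + 1)`: the waiting times between the rings are exponential of rate `K`, and each ring belongs
to a uniformly chosen edge, all independently. -/
def clockLaw (K : ℕ) : Measure (ℕ → ℝ × ZMod K) :=
  Measure.infinitePi fun _ => (expMeasure K).prod (uniformOn Set.univ)

/-- The time of the `n`-th ring, counted from `0`. -/
def ringTime (ω : ℕ → ℝ × ZMod K) (n : ℕ) : ℝ := ∑ i ∈ Finset.range (n + 1), (ω i).1

/-- The number of rings up to and including time `t`. -/
def ringCount (ω : ℕ → ℝ × ZMod K) (t : ℝ) : ℕ := sInf {n | t < ringTime ω n}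

/-- The configuration after the first `n` rings, from the initial configuration `ξ`. -/
def chain (ξ : Conf K) (ω : ℕ → ℝ × ZMod K) : ℕ → Conf K
  | 0 => ξ
  | n + 1 => flip (chain ξ ω n) (ω n).2

/-- The SSEP with traps `ξ(t)` started from `ξ`. -/
def process (ξ : Conf K) (t : ℝ) (ω : ℕ → ℝ × ZMod K) : Conf K := chain ξ ω (ringCount ω t)

/-- The transience probability `p_ξ(t) = P_ξ(ξ(t) is transient)`. -/
def transienceProb (ξ : Conf K) (t : ℝ) : ℝ≥0∞ := clockLaw K {ω | process ξ t ω ∈ transient K}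

/-- The maximal transience probability `p_K(t)`, over all initial configurations. -/
def maxTransienceProb (K : ℕ) (t : ℝ) : ℝ≥0∞ := ⨆ ξ : Conf K, transienceProb ξ t

/-! ### The process is driven by the generator -/

theorem generator_eq_sum_flip [NeZero K] (f : Conf K → ℝ) (ξ : Conf K) :
    generator f ξ = ∑ k : ZMod K, (f (flip ξ k) - f ξ) := by
  set A : ZMod K → ZMod K → ℝ := fun k l =>
    if h : CanJump ξ k l then f (jump ξ k l h) - f ξ else 0 with hA
  have h1 : generator f ξ = ∑ k : ZMod K, (A k (k + 1) + A k (k + -1)) := by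
    unfold generator
    refine Finset.sum_congr rfl fun k _ => ?_
    rw [Finset.sum_pair (by norm_num)]
    congr 1
    · simp only [hA, Int.cast_one]
    · simp only [hA, Int.cast_neg, Int.cast_one]
  have h2 : ∑ k : ZMod K, A k (k + -1) = ∑ k : ZMod K, A (k + 1) k := by
    rw [← Equiv.sum_comp (Equiv.addRight (1 : ZMod K))]
    simp
  rw [h1, Finset.sum_add_distrib, h2, ← Finset.sum_add_distrib]
  refine Finset.sum_congr rfl fun k _ => ?_
  simp only [hA, flip]
  by_cases ha : CanJump ξ k (k + 1)
  · have hb : ¬ CanJump ξ (k + 1) k := fun hb => by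
      have := ha.1; have := hb.2; omega
    rw [dif_pos ha, dif_neg hb, dif_pos ha, add_zero]
  · by_cases hb : CanJump ξ (k + 1) k
    · rw [dif_neg ha, dif_pos hb, dif_neg ha, dif_pos hb, zero_add]
    · rw [dif_neg ha, dif_neg hb, dif_neg ha, dif_neg hb, add_zero, sub_self]

instance [NeZero K] : IsProbabilityMeasure (expMeasure K) :=
  isProbabilityMeasure_expMeasure (by exact_mod_cast Nat.pos_of_ne_zero (NeZero.ne K))

instance [NeZero K] : IsProbabilityMeasure (clockLaw K) := by
  unfold clockLaw; infer_instance

/-- The sequence of rings with a first ring put in front. -/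
def cons (p : (ℝ × ZMod K) × (ℕ → ℝ × ZMod K)) : ℕ → ℝ × ZMod K
  | 0 => p.1
  | n + 1 => p.2 n

theorem measurable_cons : Measurable (cons (K := K)) := by
  refine measurable_pi_lambda _ fun n => ?_
  cases n with
  | zero => exact measurable_fst
  | succ n => exact (measurable_pi_apply n).comp measurable_snd

theorem map_cons [NeZero K] :
    (((expMeasure K).prod (uniformOn Set.univ)).prod (clockLaw K)).map cons = clockLaw K := by
  refine Measure.eq_infinitePi _ fun s t ht => ?_
  classical
  obtain ⟨n, hn⟩ := s.exists_nat_subset_range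
  set t' : ℕ → Set (ℝ × ZMod K) := fun i => if i ∈ s then t i else Set.univ with ht'
  have ht'm : ∀ i, MeasurableSet (t' i) := fun i => by
    simp only [ht']; split_ifs
    · exact ht i
    · exact .univ
  have hn' : s ⊆ Finset.range (n + 1) := hn.trans (Finset.range_mono (Nat.le_succ n))
  have hpi : Set.pi (s : Set ℕ) t = Set.pi (Finset.range (n + 1) : Set ℕ) t' := by
    ext x
    simp only [Set.mem_pi, Finset.mem_coe, ht']
    constructor
    · intro h i _
      split_ifs with hi
      · exact h i hi
      · trivial
    · intro h i hi
      have := h i (hn' hi)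
      rwa [if_pos hi] at this
  have hprod : ∏ i ∈ s, ((expMeasure K).prod (uniformOn Set.univ)) (t i) =
      ∏ i ∈ Finset.range (n + 1), ((expMeasure K).prod (uniformOn Set.univ)) (t' i) := by
    rw [← Finset.prod_subset hn']
    · exact Finset.prod_congr rfl fun i hi => by simp [ht', hi]
    · intro i _ hi
      simp [ht', hi]
  have hpre : cons ⁻¹' (Set.pi (Finset.range (n + 1) : Set ℕ) t') =
      t' 0 ×ˢ Set.pi (Finset.range n : Set ℕ) (fun i => t' (i + 1)) := by
    ext p
    simp only [Set.mem_preimage, Set.mem_pi, Finset.mem_coe, Finset.mem_range, Set.mem_prod]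
    constructor
    · intro h
      exact ⟨h 0 (by omega), fun i hi => h (i + 1) (by omega)⟩
    · rintro ⟨h0, h⟩ i hi
      cases i with
      | zero => exact h0
      | succ i => exact h i (by omega)
  rw [hpi, hprod, Measure.map_apply measurable_cons
    (MeasurableSet.pi (Finset.countable_toSet _) fun i _ => ht'm i), hpre, Measure.prod_prod,
    clockLaw, Measure.infinitePi_pi _ (fun i _ => ht'm (i + 1)), Finset.prod_range_succ', mul_comm]

theorem ringTime_cons_zero (x : ℝ × ZMod K) (ω : ℕ → ℝ × ZMod K) :
    ringTime (cons (x, ω)) 0 = x.1 := by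
  simp [ringTime, cons]

theorem ringTime_cons_succ (x : ℝ × ZMod K) (ω : ℕ → ℝ × ZMod K) (n : ℕ) :
    ringTime (cons (x, ω)) (n + 1) = x.1 + ringTime ω n := by
  rw [ringTime, Finset.sum_range_succ', add_comm]; rfl

theorem chain_cons_succ (ξ : Conf K) (x : ℝ × ZMod K) (ω : ℕ → ℝ × ZMod K) (n : ℕ) :
    chain ξ (cons (x, ω)) (n + 1) = chain (flip ξ x.2) ω n := by
  induction n with
  | zero => rfl
  | succ n ih => rw [chain, ih]; rfl

theorem process_cons_of_lt (ξ : Conf K) (x : ℝ × ZMod K) (ω : ℕ → ℝ × ZMod K) {t : ℝ}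
    (h : t < x.1) : process ξ t (cons (x, ω)) = ξ := by
  have : ringCount (cons (x, ω)) t = 0 :=
    Nat.sInf_eq_zero.2 (Or.inl (by simpa [ringTime_cons_zero] using h))
  rw [process, this, chain]

theorem process_cons_of_le (ξ : Conf K) (x : ℝ × ZMod K) (ω : ℕ → ℝ × ZMod K) {t : ℝ}
    (h : x.1 ≤ t) (hω : ∃ n, t - x.1 < ringTime ω n) :
    process ξ t (cons (x, ω)) = process (flip ξ x.2) (t - x.1) ω := by
  have hs : ∀ n, n + 1 ∈ {n | t < ringTime (cons (x, ω)) n} ↔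
      n ∈ {n | t - x.1 < ringTime ω n} := fun n => by
    simp only [Set.mem_ofPred_eq, ringTime_cons_succ]
    constructor <;> intro h <;> linarith
  have h0 : 0 ∉ {n | t < ringTime (cons (x, ω)) n} := by
    simpa [ringTime_cons_zero] using h
  have : ringCount (cons (x, ω)) t = ringCount ω (t - x.1) + 1 := by
    have hne : {n | t - x.1 < ringTime ω n}.Nonempty := hω
    apply le_antisymm
    · exact Nat.sInf_le ((hs _).2 (Nat.sInf_mem hne))
    · have hne' : {n | t < ringTime (cons (x, ω)) n}.Nonempty := 
        ⟨_, (hs _).2 (Nat.sInf_mem hne)⟩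
      have hm := Nat.sInf_mem hne'
      unfold ringCount
      rcases hN : sInf {n | t < ringTime (cons (x, ω)) n} with _ | N
      · rw [hN] at hm; exact absurd hm h0
      · rw [hN] at hm
        exact Nat.succ_le_succ (Nat.sInf_le ((hs _).1 hm))
  rw [process, this, chain_cons_succ, process]

theorem measurable_ringTime (n : ℕ) : Measurable fun ω : ℕ → ℝ × ZMod K => ringTime ω n := by
  unfold ringTime
  exact Finset.measurable_sum _ fun i _ => measurable_fst.comp (measurable_pi_apply i)

theorem measurable_ringCount :
    Measurable fun p : ℝ × (ℕ → ℝ × ZMod K) => ringCount p.2 p.1 := by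
  have hlt : ∀ n, MeasurableSet {p : ℝ × (ℕ → ℝ × ZMod K) | p.1 < ringTime p.2 n} := fun n =>
    measurableSet_lt measurable_fst ((measurable_ringTime n).comp measurable_snd)
  refine measurable_to_countable' fun n => ?_
  have : (fun p : ℝ × (ℕ → ℝ × ZMod K) => ringCount p.2 p.1) ⁻¹' {n} =
      ({p | p.1 < ringTime p.2 n} ∩ ⋂ m ∈ Set.Iio n, {p | p.1 < ringTime p.2 m}ᶜ) ∪
      ({_p | n = 0} ∩ ⋂ m, {p | p.1 < ringTime p.2 m}ᶜ) := by
    ext p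
    simp only [Set.mem_preimage, Set.mem_singleton_iff, Set.mem_union, Set.mem_inter_iff,
      Set.mem_ofPred_eq, Set.mem_iInter, Set.mem_compl_iff, Set.mem_Iio, ringCount]
    constructor
    · intro h
      by_cases hne : {m | p.1 < ringTime p.2 m}.Nonempty
      · left
        have := Nat.sInf_mem hne
        rw [h] at this
        exact ⟨this, fun m hm => Nat.notMem_of_lt_sInf (by rw [h]; exact hm)⟩
      · right
        rw [Set.not_nonempty_iff_eq_empty] at hne
        refine ⟨by rw [← h, hne, Nat.sInf_empty], fun m hm => ?_⟩
        have : m ∈ {m | p.1 < ringTime p.2 m} := hm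
        rw [hne] at this
        exact this
    · rintro (⟨h1, h2⟩ | ⟨rfl, h2⟩)
      · refine le_antisymm (Nat.sInf_le h1) ?_
        by_contra hlt'
        push Not at hlt'
        exact h2 _ hlt' (Nat.sInf_mem (s := {m | p.1 < ringTime p.2 m}) ⟨n, h1⟩)
      · exact Nat.sInf_eq_zero.2 (Or.inr (Set.eq_empty_of_forall_notMem h2))
  rw [this]
  refine ((hlt n).inter (MeasurableSet.biInter (Set.to_countable _) fun m _ => (hlt m).compl)).union
    ((MeasurableSet.const _).inter (MeasurableSet.iInter fun m => (hlt m).compl))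

theorem measurable_chain [NeZero K] (ξ : Conf K) (n : ℕ) :
    Measurable fun ω : ℕ → ℝ × ZMod K => chain ξ ω n := by
  induction n with
  | zero => exact measurable_const
  | succ n ih =>
    have : Measurable fun p : Conf K × ZMod K => flip p.1 p.2 := measurable_of_countable _
    exact this.comp (ih.prodMk (measurable_snd.comp (measurable_pi_apply n)))

theorem measurable_process [NeZero K] (ξ : Conf K) :
    Measurable fun p : ℝ × (ℕ → ℝ × ZMod K) => process ξ p.1 p.2 := by
  have : Measurable fun q : ℕ × (ℕ → ℝ × ZMod K) => chain ξ q.2 q.1 :=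
    measurable_from_prod_countable_right fun n => measurable_chain ξ n
  exact this.comp (measurable_ringCount.prodMk measurable_snd)

theorem expMeasure_Iic [NeZero K] (t : ℝ) :
    expMeasure K (Set.Iic t) = ENNReal.ofReal (if 0 ≤ t then 1 - Real.exp (-(K * t)) else 0) := by
  have hK : (0 : ℝ) < K := by exact_mod_cast Nat.pos_of_ne_zero (NeZero.ne K)
  rw [← ofReal_cdf, cdf_expMeasure_eq hK]

theorem ae_exists_lt_ringTime [NeZero K] :
    ∀ᵐ ω ∂clockLaw K, ∀ t : ℝ, ∃ n, t < ringTime ω n := by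
  have hK : (0 : ℝ) < K := by exact_mod_cast Nat.pos_of_ne_zero (NeZero.ne K)
  have main : ∀ t : ℝ, clockLaw K {ω | ∀ n, ringTime ω n ≤ t} = 0 := by
    intro t
    set E : ℝ → Set (ℕ → ℝ × ZMod K) := fun t => {ω | ∀ n, ringTime ω n ≤ t} with hE
    have hEm : MeasurableSet (E t) := by
      have : E t = ⋂ n, {ω | ringTime ω n ≤ t} := by ext ω; simp [hE]
      rw [this]
      exact MeasurableSet.iInter fun n => measurableSet_le (measurable_ringTime n) measurable_const
    have hpos : ∀ᵐ p ∂(((expMeasure K).prod (uniformOn (Set.univ : Set (ZMod K)))).prod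
        (clockLaw K)), 0 < p.1.1 := by
      have h0 : ∀ᵐ s ∂expMeasure (K : ℝ), 0 < s := by
        rw [ae_iff]
        have : {a : ℝ | ¬ 0 < a} = Set.Iic 0 := by ext; simp
        rw [this, expMeasure_Iic]
        simp
      exact (Measure.quasiMeasurePreserving_fst.comp
        Measure.quasiMeasurePreserving_fst).ae h0
    have hle : clockLaw K (E t) ≤ expMeasure K (Set.Iic t) * clockLaw K (E t) := by
      conv_lhs => rw [← map_cons, Measure.map_apply measurable_cons hEm]
      calc _ ≤ (((expMeasure K).prod (uniformOn (Set.univ : Set (ZMod K)))).prod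
            (clockLaw K)) ((Set.Iic t ×ˢ Set.univ) ×ˢ E t) := by
            refine measure_mono_ae ?_
            filter_upwards [hpos] with p hp hpE
            have hpE' : ∀ n, ringTime (cons (p.1, p.2)) n ≤ t := hpE
            have h0 := hpE' 0
            rw [ringTime_cons_zero] at h0
            refine ⟨⟨h0, trivial⟩, fun n => ?_⟩
            have := hpE' (n + 1)
            rw [ringTime_cons_succ] at this
            linarith
        _ = _ := by
            rw [Measure.prod_prod, Measure.prod_prod, measure_univ, mul_one]
    have hlt : expMeasure K (Set.Iic t) < 1 := by
      rw [expMeasure_Iic, ENNReal.ofReal_lt_one]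
      split_ifs
      · linarith [Real.exp_pos (-(K * t))]
      · exact one_pos
    by_contra hne
    have h2 : expMeasure K (Set.Iic t) * clockLaw K (E t) < 1 * clockLaw K (E t) :=
      ENNReal.mul_lt_mul_left hne (measure_ne_top _ _) hlt
    rw [one_mul] at h2
    exact absurd hle (not_le.2 h2)
  have : ∀ᵐ ω ∂clockLaw K, ∀ m : ℕ, ∃ n, (m : ℝ) < ringTime ω n := by
    rw [ae_all_iff]
    intro m
    rw [ae_iff]
    simpa using main m
  filter_upwards [this] with ω hω t
  obtain ⟨m, hm⟩ := exists_nat_gt t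
  obtain ⟨n, hn⟩ := hω m
  exact ⟨n, hm.trans hn⟩

theorem abs_integral_process_le [NeZero K] {f : Conf K → ℝ} {C : ℝ} (hf : ∀ ξ, |f ξ| ≤ C)
    (ξ : Conf K) (t : ℝ) : |∫ ω, f (process ξ t ω) ∂clockLaw K| ≤ C := by
  have := norm_integral_le_of_norm_le_const (μ := clockLaw K) (f := fun ω => f (process ξ t ω))
    (C := C) (Eventually.of_forall fun ω => by simpa using hf _)
  simpa using this

theorem measurable_integral_process [NeZero K] (f : Conf K → ℝ) (ξ : Conf K) :
    Measurable fun t : ℝ => ∫ ω, f (process ξ t ω) ∂clockLaw K := by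
  have h : Measurable fun p : ℝ × (ℕ → ℝ × ZMod K) => f (process ξ p.1 p.2) :=
    (measurable_of_countable f).comp (measurable_process ξ)
  exact (StronglyMeasurable.integral_prod_right h.stronglyMeasurable).measurable

/-- Decomposition at the time of the first ring. -/
theorem integral_process_eq [NeZero K] {f : Conf K → ℝ} {C : ℝ} (hf : ∀ ξ, |f ξ| ≤ C)
    (ξ : Conf K) {t : ℝ} (ht : 0 ≤ t) :
    ∫ ω, f (process ξ t ω) ∂clockLaw K = Real.exp (-(K * t)) * (f ξ +
      ∫ r in (0 : ℝ)..t, Real.exp (K * r) *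
        ∑ k : ZMod K, ∫ ω, f (process (flip ξ k) r ω) ∂clockLaw K) := by
  have hK : (0 : ℝ) < K := by exact_mod_cast Nat.pos_of_ne_zero (NeZero.ne K)
  set u : ℝ → Conf K → ℝ := fun t ξ => ∫ ω, f (process ξ t ω) ∂clockLaw K with hu
  have hum : ∀ ξ, Measurable fun t => u t ξ := measurable_integral_process f
  have hub : ∀ ξ t, |u t ξ| ≤ C := fun ξ t => abs_integral_process_le hf ξ t
  have hfm : ∀ (ξ : Conf K) (t : ℝ), Measurable fun ω => f (process ξ t ω) := fun ξ t =>
    (measurable_of_countable f).comp ((measurable_process ξ).comp measurable_prodMk_left)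
  set ν : Measure (ℝ × ZMod K) := (expMeasure K).prod (uniformOn Set.univ) with hν
  -- the function of the first ring
  set G : ℝ × ZMod K → ℝ := fun x => if t < x.1 then f ξ else u (t - x.1) (flip ξ x.2) with hG
  have hGm : Measurable G := by
    refine Measurable.ite (measurableSet_lt measurable_const measurable_fst) measurable_const ?_
    have : Measurable fun q : ℝ × ZMod K => u q.1 (flip ξ q.2) :=
      measurable_from_prod_countable_left fun k => hum (flip ξ k)
    exact this.comp ((measurable_const.sub measurable_fst).prodMk measurable_snd)
  have hGb : ∀ x, |G x| ≤ C := fun x => by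
    simp only [hG]; split_ifs
    · exact hf _
    · exact hub _ _
  have step1 : u t ξ = ∫ x, G x ∂ν := by
    have hm : Measurable fun p => f (process ξ t (cons (K := K) p)) :=
      (hfm ξ t).comp measurable_cons
    have hi : Integrable (fun p => f (process ξ t (cons (K := K) p))) (ν.prod (clockLaw K)) :=
      Integrable.of_bound hm.aestronglyMeasurable C (Eventually.of_forall fun p => hf _)
    calc u t ξ = ∫ p, f (process ξ t (cons p)) ∂(ν.prod (clockLaw K)) := by
          simp only [hu]
          conv_lhs => rw [← map_cons]
          rw [integral_map measurable_cons.aemeasurable (hfm ξ t).aestronglyMeasurable]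
      _ = ∫ x, ∫ ω, f (process ξ t (cons (x, ω))) ∂clockLaw K ∂ν := integral_prod _ hi
      _ = ∫ x, G x ∂ν := by
          refine integral_congr_ae (Eventually.of_forall fun x => ?_)
          simp only [hG]
          split_ifs with hx
          · simp [process_cons_of_lt ξ x _ hx]
          · refine integral_congr_ae ?_
            filter_upwards [ae_exists_lt_ringTime (K := K)] with ω hω
            rw [process_cons_of_le ξ x ω (not_lt.1 hx) (hω _)]
  have step2 : ∫ x, G x ∂ν = ∫ s, (K : ℝ)⁻¹ * ∑ k : ZMod K, G (s, k) ∂expMeasure K := by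
    rw [hν, integral_prod _ (Integrable.of_bound hGm.aestronglyMeasurable C
      (Eventually.of_forall hGb))]
    refine integral_congr_ae (Eventually.of_forall fun s => ?_)
    simp only
    rw [integral_fintype (Integrable.of_finite), Finset.mul_sum]
    refine Finset.sum_congr rfl fun k _ => ?_
    rw [measureReal_def, uniformOn_univ, Measure.count_singleton, ZMod.card]
    simp
  have hdens : expMeasure (K : ℝ) = volume.withDensity (exponentialPDF K) := rfl
  have hpdf : Measurable (exponentialPDF (K : ℝ)) :=
    (measurable_exponentialPDFReal _).ennreal_ofReal
  set J : ℝ → ℝ := fun s => (K : ℝ)⁻¹ * ∑ k : ZMod K, u (t - s) (flip ξ k) with hJ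
  have hJm : Measurable J := by
    refine Measurable.const_mul (Finset.measurable_sum _ fun k _ => ?_) _
    exact (hum _).comp (measurable_const.sub measurable_id)
  have hJb : ∀ s, |J s| ≤ C := fun s => by
    rw [hJ]; simp only
    rw [abs_mul, abs_of_pos (inv_pos.2 hK), inv_mul_le_iff₀ hK]
    calc _ ≤ ∑ k : ZMod K, |u (t - s) (flip ξ k)| := Finset.abs_sum_le_sum_abs _ _
      _ ≤ ∑ k : ZMod K, C := Finset.sum_le_sum fun k _ => hub _ _
      _ = K * C := by simp [ZMod.card]
  have step3 : ∫ s, (K : ℝ)⁻¹ * ∑ k : ZMod K, G (s, k) ∂expMeasure K =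
      Real.exp (-(K * t)) * f ξ + ∫ s in Set.Iic t, J s ∂expMeasure K := by
    have hint : Integrable (fun s => (K : ℝ)⁻¹ * ∑ k : ZMod K, G (s, k)) (expMeasure K) := by
      refine (integrable_finsetSum _ fun k _ => ?_).const_mul _
      exact Integrable.of_bound (hGm.comp measurable_prodMk_right).aestronglyMeasurable C
        (Eventually.of_forall fun s => hGb _)
    rw [← integral_add_compl (measurableSet_Iic (a := t)) hint, add_comm]
    congr 1
    · rw [Set.compl_Iic]
      have : ∀ s ∈ Set.Ioi t, (K : ℝ)⁻¹ * ∑ k : ZMod K, G (s, k) = f ξ := fun s hs => by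
        have hs' : t < s := hs
        simp only [hG, if_pos hs', Finset.sum_const, Finset.card_univ, ZMod.card, nsmul_eq_mul]
        field_simp
      rw [setIntegral_congr_fun measurableSet_Ioi this, setIntegral_const, smul_eq_mul]
      congr 1
      rw [← Set.compl_Iic, probReal_compl_eq_one_sub measurableSet_Iic, measureReal_def,
        expMeasure_Iic, if_pos ht, ENNReal.toReal_ofReal]
      · ring
      · have : Real.exp (-(K * t)) ≤ 1 := Real.exp_le_one_iff.2 (by
          have := mul_nonneg hK.le ht; linarith)
        linarith
    · refine setIntegral_congr_fun measurableSet_Iic fun s hs => ?_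
      have hs' : ¬ t < s := not_lt.2 hs
      simp only [hG, hJ, if_neg hs']
  have step4 : ∫ s in Set.Iic t, J s ∂expMeasure K =
      ∫ s in (0 : ℝ)..t, K * Real.exp (-(K * s)) * J s := by
    rw [hdens, restrict_withDensity measurableSet_Iic,
      integral_withDensity_eq_integral_toReal_smul hpdf
        (Eventually.of_forall fun s => ENNReal.ofReal_lt_top),
      intervalIntegral.integral_of_le ht, ← integral_Icc_eq_integral_Ioc,
      ← integral_indicator measurableSet_Iic, ← integral_indicator measurableSet_Icc]
    refine integral_congr_ae (Eventually.of_forall fun s => ?_)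
    simp only [Set.indicator, Set.mem_Iic, Set.mem_Icc, smul_eq_mul]
    by_cases h0 : 0 ≤ s
    · rw [exponentialPDF_of_nonneg h0, ENNReal.toReal_ofReal (by positivity)]
      simp [h0]
    · rw [exponentialPDF_of_neg (not_le.1 h0)]
      simp [h0]
  have step5 : ∫ s in (0 : ℝ)..t, K * Real.exp (-(K * s)) * J s =
      Real.exp (-(K * t)) * ∫ r in (0 : ℝ)..t, Real.exp (K * r) *
        ∑ k : ZMod K, u r (flip ξ k) := by
    have h := intervalIntegral.integral_comp_sub_left (a := 0) (b := t)
      (fun r => Real.exp (K * r) * ∑ k : ZMod K, u r (flip ξ k)) t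
    rw [sub_zero, sub_self] at h
    rw [← h, ← intervalIntegral.integral_const_mul]
    refine intervalIntegral.integral_congr fun s _ => ?_
    simp only [hJ]
    have : Real.exp (-(K * s)) = Real.exp (-(K * t)) * Real.exp (K * (t - s)) := by
      rw [← Real.exp_add]; congr 1; ring
    rw [this]
    field_simp
  change u t ξ = _
  rw [step1, step2, step3, step4, step5, mul_add]

theorem integral_process_zero [NeZero K] {f : Conf K → ℝ} {C : ℝ} (hf : ∀ ξ, |f ξ| ≤ C)
    (ξ : Conf K) : ∫ ω, f (process ξ 0 ω) ∂clockLaw K = f ξ := by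
  simpa using integral_process_eq hf ξ le_rfl

/-- The process is driven by the generator: for bounded `f`, the function
`u(t, ξ) = E_ξ[f(ξ(t))]` satisfies the Kolmogorov equation `∂ₜ u = L u`, `u(0, ·) = f`. -/
theorem hasDerivWithinAt_integral_process [NeZero K] {f : Conf K → ℝ} {C : ℝ}
    (hf : ∀ ξ, |f ξ| ≤ C) (ξ : Conf K) {t : ℝ} (ht : 0 ≤ t) :
    HasDerivWithinAt (fun s => ∫ ω, f (process ξ s ω) ∂clockLaw K)
      (generator (fun ξ' => ∫ ω, f (process ξ' t ω) ∂clockLaw K) ξ) (Set.Ici 0) t := by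
  set u : ℝ → Conf K → ℝ := fun t ξ => ∫ ω, f (process ξ t ω) ∂clockLaw K with hu
  have hum : ∀ ξ, Measurable fun t => u t ξ := measurable_integral_process f
  have hub : ∀ ξ t, |u t ξ| ≤ C := fun ξ t => abs_integral_process_le hf ξ t
  have hC : 0 ≤ C := (abs_nonneg _).trans (hf ξ)
  have hcont : ∀ ξ, ContinuousOn (fun t => u t ξ) (Set.Ici 0) := by
    intro ξ
    have hc : Continuous fun t : ℝ => Real.exp (-(K * t)) * (f ξ +
        ∫ r in (0 : ℝ)..t, Real.exp (K * r) * ∑ k : ZMod K, u r (flip ξ k)) := by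
      refine Continuous.mul (by fun_prop) (continuous_const.add ?_)
      refine intervalIntegral.continuous_primitive (fun a b => ?_) 0
      have hs : IntervalIntegrable (fun r => ∑ k : ZMod K, u r (flip ξ k)) volume a b := by
        refine IntervalIntegrable.mono_fun' (g := fun _ => K * C) intervalIntegrable_const
          (Finset.measurable_sum _ fun k _ => hum _).aestronglyMeasurable
          (Eventually.of_forall fun r => ?_)
        calc _ ≤ ∑ k : ZMod K, |u r (flip ξ k)| := Finset.abs_sum_le_sum_abs _ _
          _ ≤ ∑ k : ZMod K, C := Finset.sum_le_sum fun k _ => hub _ _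
          _ = K * C := by simp [ZMod.card]
      exact hs.continuousOn_mul (by fun_prop)
    refine hc.continuousOn.congr fun t ht => ?_
    exact integral_process_eq hf ξ ht
  set v : ℝ → ℝ := fun r => Real.exp (K * r) * ∑ k : ZMod K, u (max r 0) (flip ξ k) with hv
  have hvc : Continuous v := by
    refine Continuous.mul (by fun_prop) (continuous_finsetSum _ fun k _ => ?_)
    exact (hcont _).comp_continuous (by fun_prop) fun r => le_max_right r 0
  have heq : ∀ s ∈ Set.Ici (0 : ℝ), u s ξ =
      Real.exp (-(K * s)) * (f ξ + ∫ r in (0 : ℝ)..s, v r) := by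
    intro s hs
    rw [hu]; simp only
    rw [integral_process_eq hf ξ hs]
    congr 2
    refine intervalIntegral.integral_congr fun r hr => ?_
    rw [Set.uIcc_of_le hs] at hr
    simp only [hv, max_eq_left hr.1, hu]
  have hd : HasDerivAt (fun s : ℝ => Real.exp (-(K * s)) * (f ξ + ∫ r in (0 : ℝ)..s, v r))
      (Real.exp (-(K * t)) * (-K) * (f ξ + ∫ r in (0 : ℝ)..t, v r) +
        Real.exp (-(K * t)) * v t) t := by
    refine HasDerivAt.mul ?_ ((hvc.integral_hasStrictDerivAt 0 t).hasDerivAt.const_add _)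
    have : HasDerivAt (fun s : ℝ => -(K * s)) (-(K : ℝ)) t := by
      have h := hasDerivAt_mul_const (x := t) (-(K : ℝ))
      have he : (fun s : ℝ => -(K * s)) = fun s : ℝ => s * -(K : ℝ) := by
        funext s; ring
      rw [he]; exact h
    exact this.exp
  have hfin := hd.hasDerivWithinAt.congr_of_mem heq ht
  have h1 := heq t ht
  have h2 : Real.exp (-(K * t)) * v t = ∑ k : ZMod K, u t (flip ξ k) := by
    simp only [hv, max_eq_left ht]
    rw [← mul_assoc, ← Real.exp_add]
    simp
  have h3 : generator (u t) ξ = Real.exp (-(K * t)) * (-K) * (f ξ + ∫ r in (0 : ℝ)..t, v r) +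
      Real.exp (-(K * t)) * v t := by
    rw [generator_eq_sum_flip, Finset.sum_sub_distrib, h2, mul_right_comm, ← h1]
    simp [ZMod.card]
    ring
  rw [← h3] at hfin
  exact hfin

end SWT

end

namespace SWT

variable {K : ℕ}

/-! If a configuration is transient after `n` rings, it still has a particle at some site and a trap
at some `y`. Traced backwards through the rings, the particle lies on a stirring walk from some `x`
that carried a particle throughout. Traps never appear or deepen, so `y` was a trap all along and
the walk never visited it: a walk reaching a trap loses its particle. This is
`exists_avoid_of_transient`. It replaces the interacting system by `K ^ 2` events `avoid x y n`,
each about a single symmetric walk on the ring.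

A single walk avoids `y` for `n` rings with probability at most `2 exp(-n / K ^ 3)`
(`clockLaw_avoid_le`). Indeed `z (K - z)`, with `z` the distance from `y` along the ring, loses `2 /
K` on average per ring; adding `K ^ 2` keeps it between `K ^ 2` and `2 K ^ 2`, which turns this loss
into a contraction by `1 - 1 / K ^ 3`.

By Markov's inequality fewer than `n` rings occur before time `T` with probability at most `n / (K
T)` (`clockLaw_ringCount_lt_le`). At `T = t K ^ 2 log K` the mean number of rings is `t K ^ 3 log
K`; taking `n` about `√t K ^ 3 log K` makes this term `O(1 / √t)`, while the union over `K ^ 2`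
pairs contributes at most `2 K ^ (2 - √t)`. The logarithm pays for the union bound, and both terms
vanish uniformly in `K ≥ 2`. -/

/-- The position after `n` rings of the stirring walk started from `x`: at each ring of an edge, the
walk crosses this edge if it sits at one of its ends. -/
def walk (x : ZMod K) (ω : ℕ → ℝ × ZMod K) : ℕ → ZMod K
  | 0 => x
  | n + 1 => Equiv.swap (ω n).2 ((ω n).2 + 1) (walk x ω n)

theorem walk_cons_succ (x : ZMod K) (p : ℝ × ZMod K) (ω : ℕ → ℝ × ZMod K) (n : ℕ) :
    walk x (cons (p, ω)) (n + 1) = walk (Equiv.swap p.2 (p.2 + 1) x) ω n := by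
  induction n with
  | zero => rfl
  | succ n ih => rw [walk, ih]; rfl

theorem measurable_walk [NeZero K] (x : ZMod K) (n : ℕ) :
    Measurable fun ω : ℕ → ℝ × ZMod K => walk x ω n := by
  induction n with
  | zero => exact measurable_const
  | succ n ih =>
    have : Measurable fun p : ZMod K × ZMod K => Equiv.swap p.1 (p.1 + 1) p.2 :=
      measurable_of_countable _
    exact this.comp ((measurable_snd.comp (measurable_pi_apply n)).prodMk ih)

/-! ### Particles follow stirring walks, traps only get shallower -/

/-- A ring leaves the edge unchanged, exchanges a particle with an empty site, or lets a trap absorb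
a particle. Up to the swap, none of these creates a particle. -/
theorem eq_one_of_flip_swap_eq_one (ξ : Conf K) (k j : ZMod K)
    (h : (flip ξ k).1 (Equiv.swap k (k + 1) j) = 1) : ξ.1 j = 1 := by
  have h1 := ξ.2 k
  have h2 := ξ.2 (k + 1)
  simp only [flip, jump, CanJump, Equiv.swap_apply_def] at h
  split_ifs at h <;> simp_all <;> grind

/-- A jump sets its source to `0` and raises its target, so no value becomes negative. -/
theorem lt_zero_of_flip_lt_zero (ξ : Conf K) (k j : ZMod K) (h : (flip ξ k).1 j < 0) :
    ξ.1 j < 0 := by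
  simp only [flip, jump, CanJump] at h
  split_ifs at h <;> simp_all <;> grind

theorem exists_walk_of_chain_eq_one (ξ : Conf K) (ω : ℕ → ℝ × ZMod K) (n : ℕ) (k : ZMod K)
    (h : (chain ξ ω n).1 k = 1) :
    ∃ x, walk x ω n = k ∧ ∀ m ≤ n, (chain ξ ω m).1 (walk x ω m) = 1 := by
  induction n generalizing k with
  | zero => exact ⟨k, rfl, fun m hm => by obtain rfl := Nat.le_zero.1 hm; exact h⟩
  | succ n ih =>
    set e := (ω n).2 with he
    -- The swap is its own inverse, so it also gives the site occupied just before the last ring.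
    obtain ⟨x, hx, hm⟩ := ih (Equiv.swap e (e + 1) k)
      (eq_one_of_flip_swap_eq_one _ e _ (by rw [Equiv.swap_apply_self]; exact h))
    have hk : walk x ω (n + 1) = k := by rw [walk, hx, ← he, Equiv.swap_apply_self]
    refine ⟨x, hk, fun m hmn => ?_⟩
    rcases Nat.le_succ_iff.1 hmn with hmn | rfl
    · exact hm m hmn
    · rw [hk]; exact h

theorem chain_lt_zero_of_le (ξ : Conf K) (ω : ℕ → ℝ × ZMod K) {m n : ℕ} (hmn : m ≤ n) (k : ZMod K)
    (h : (chain ξ ω n).1 k < 0) : (chain ξ ω m).1 k < 0 := by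
  induction n, hmn using Nat.le_induction with
  | base => exact h
  | succ n _ ih => exact ih (lt_zero_of_flip_lt_zero _ _ _ h)

/-- The event that the stirring walk from `x` does not visit `y` during the first `n` rings. -/
def avoid (x y : ZMod K) (n : ℕ) : Set (ℕ → ℝ × ZMod K) := {ω | ∀ m ≤ n, walk x ω m ≠ y}

theorem avoid_anti (x y : ZMod K) {m n : ℕ} (h : m ≤ n) : avoid x y n ⊆ avoid x y m :=
  fun _ hω i hi => hω i (hi.trans h)

/-- At each ring the walk sits on the value `1` while `y` carries a negative value, so the two sites
differ. -/
theorem exists_avoid_of_transient (ξ : Conf K) (ω : ℕ → ℝ × ZMod K) (n : ℕ)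
    (h : chain ξ ω n ∈ transient K) : ∃ x y, ω ∈ avoid x y n := by
  obtain ⟨⟨y, hy⟩, k, hk⟩ := h
  obtain ⟨x, -, hx⟩ := exists_walk_of_chain_eq_one ξ ω n k hk
  refine ⟨x, y, fun m hm he => ?_⟩
  have h1 := hx m hm
  have h2 := chain_lt_zero_of_le ξ ω hm y hy
  rw [he] at h1
  omega

theorem measurableSet_avoid [NeZero K] (x y : ZMod K) (n : ℕ) : MeasurableSet (avoid x y n) := by
  have : avoid x y n = ⋂ m ∈ Set.Iic n, (fun ω => walk x ω m) ⁻¹' {y}ᶜ := by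
    ext ω; simp [avoid]
  rw [this]
  exact MeasurableSet.biInter (Set.to_countable _) fun m _ =>
    measurable_walk x m (MeasurableSet.of_discrete)

/-! ### The stirring walk hits every site -/

theorem lintegral_uniformOn_univ [NeZero K] (f : ZMod K → ℝ≥0∞) :
    ∫⁻ k, f k ∂uniformOn (Set.univ : Set (ZMod K)) = (K : ℝ≥0∞)⁻¹ * ∑ k, f k := by
  rw [lintegral_fintype, Finset.mul_sum]
  refine Finset.sum_congr rfl fun k _ => ?_
  rw [uniformOn_univ, Measure.count_singleton, ZMod.card, mul_comm, one_div]

/-- First ring decomposition of the avoidance probability. -/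
theorem clockLaw_avoid_succ_le [NeZero K] (x y : ZMod K) (n : ℕ) :
    clockLaw K (avoid x y (n + 1)) ≤
      (K : ℝ≥0∞)⁻¹ * ∑ k, clockLaw K (avoid (Equiv.swap k (k + 1) x) y n) := by
  have hm : Measurable fun k : ZMod K => clockLaw K (avoid (Equiv.swap k (k + 1) x) y n) :=
    measurable_of_countable _
  conv_lhs => rw [← map_cons, Measure.map_apply measurable_cons (measurableSet_avoid x y _),
    Measure.prod_apply (measurable_cons (measurableSet_avoid x y _))]
  calc _ ≤ ∫⁻ p, clockLaw K (avoid (Equiv.swap p.2 (p.2 + 1) x) y n)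
        ∂((expMeasure K).prod (uniformOn Set.univ)) := by
        -- Only an inequality results, because the condition that the starting point differs from
        -- `y` is dropped.
        refine lintegral_mono fun p => measure_mono fun ω hω m hmn => ?_
        rw [← walk_cons_succ]
        exact hω (m + 1) (Nat.succ_le_succ hmn)
    _ = _ := by
        have hm' : Measurable fun p : ℝ × ZMod K =>
            clockLaw K (avoid (Equiv.swap p.2 (p.2 + 1) x) y n) := hm.comp measurable_snd
        rw [lintegral_prod _ hm'.aemeasurable]
        simp [lintegral_uniformOn_univ]

/-- A function on the ring that is strictly superharmonic away from `y`. -/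
def barrier (y x : ZMod K) : ℝ := K ^ 2 + (x - y).val * (K - (x - y).val)

/-- The lower bound starts the induction on the number of rings; the upper bound makes an additive
loss proportional to the barrier itself. -/
theorem barrier_bounds [NeZero K] (y x : ZMod K) :
    (K : ℝ) ^ 2 ≤ barrier y x ∧ barrier y x ≤ 2 * (K : ℝ) ^ 2 := by
  have h : ((x - y).val : ℝ) ≤ K := by exact_mod_cast (ZMod.val_lt (x - y)).le
  have h0 : (0 : ℝ) ≤ (x - y).val := Nat.cast_nonneg _
  unfold barrier
  constructor <;> nlinarith

/-- The second difference of `z (K - z)` is `-2`. Away from `y` the representative of `x - y` is at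
least `1`, so stepping down does not wrap around. -/
theorem barrier_add_one_add_barrier_sub_one (hK : 2 ≤ K) {x y : ZMod K} (h : x ≠ y) :
    barrier y (x + 1) + barrier y (x - 1) = 2 * barrier y x - 2 := by
  have : NeZero K := ⟨by omega⟩
  have : Fact (1 < K) := ⟨hK⟩
  unfold barrier
  set z := x - y with hz
  have hz0 : z ≠ 0 := sub_ne_zero.2 h
  have hpos : 1 ≤ z.val := Nat.one_le_iff_ne_zero.2 (by simpa [ZMod.val_eq_zero] using hz0)
  have h1 : x + 1 - y = z + 1 := by rw [hz]; ring
  have h2 : x - 1 - y = z - 1 := by rw [hz]; ring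
  have h3 : ((z - 1).val : ℝ) = z.val - 1 := by
    rw [ZMod.val_sub (by rwa [ZMod.val_one]), ZMod.val_one, Nat.cast_sub hpos, Nat.cast_one]
  -- Stepping up wraps from `K - 1` to `0`, which is harmless since the polynomial vanishes at both
  -- `0` and `K`.
  have h4 : ((z + 1).val : ℝ) * (K - (z + 1).val) = (z.val + 1) * (K - (z.val + 1)) := by
    rcases lt_or_ge (z.val + 1) K with hlt | hge
    · rw [ZMod.val_add_of_lt (by rwa [ZMod.val_one]), ZMod.val_one]
      push_cast; ring
    · have := ZMod.val_lt z
      have he : z.val + 1 = K := by omega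
      rw [ZMod.val_add_of_le (by rwa [ZMod.val_one]), ZMod.val_one, he]
      have : ((z.val : ℝ) + 1) = K := by exact_mod_cast he
      rw [this]; simp
  rw [h1, h2, h3, h4]
  ring

/-- Only the two edges at `x` move the walk, so a discrete Laplacian remains. For `K ≥ 2` these
edges are distinct, even when `K = 2` and their other ends coincide. -/
theorem sum_swap_apply [NeZero K] (hK : 2 ≤ K) (f : ZMod K → ℝ) (x : ZMod K) :
    ∑ k, f (Equiv.swap k (k + 1) x) = K * f x + (f (x + 1) + f (x - 1) - 2 * f x) := by
  have : Fact (1 < K) := ⟨hK⟩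
  have hne : x - 1 ≠ x := by simp
  have key : ∀ k, f (Equiv.swap k (k + 1) x) = f x +
      ((if k = x then f (x + 1) - f x else 0) + if k = x - 1 then f (x - 1) - f x else 0) := by
    intro k
    by_cases h1 : k = x
    · subst h1; simp [hne.symm]
    · by_cases h2 : k = x - 1
      · subst h2; simp
      · rw [Equiv.swap_apply_of_ne_of_ne (Ne.symm h1) (fun h => h2 (by rw [h]; ring))]
        simp [h1, h2]
  simp only [key, Finset.sum_add_distrib, Finset.sum_ite_eq', Finset.mem_univ, if_true]
  simp [ZMod.card]
  ring

theorem clockLaw_avoid_le_barrier [NeZero K] (hK : 2 ≤ K) (x y : ZMod K) (n : ℕ) :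
    clockLaw K (avoid x y n) ≤
      ENNReal.ofReal (barrier y x / (K : ℝ) ^ 2 * (1 - 1 / (K : ℝ) ^ 3) ^ n) := by
  have hK2 : (2 : ℝ) ≤ K := by exact_mod_cast hK
  have hK0 : (0 : ℝ) < K := by linarith
  have hr : 0 ≤ 1 - 1 / (K : ℝ) ^ 3 := by
    rw [sub_nonneg, div_le_one (by positivity)]
    exact one_le_pow₀ (by linarith)
  have hb : ∀ x : ZMod K, 0 ≤ barrier y x := fun x =>
    (by positivity : (0 : ℝ) ≤ (K : ℝ) ^ 2).trans (barrier_bounds y x).1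
  induction n generalizing x with
  | zero =>
    refine prob_le_one.trans ?_
    rw [pow_zero, mul_one, ENNReal.one_le_ofReal, one_le_div (by positivity)]
    exact (barrier_bounds y x).1
  | succ n ih =>
    by_cases hxy : x = y
    · have : avoid x y (n + 1) = ∅ := Set.eq_empty_of_forall_notMem fun ω h =>
        h 0 (Nat.zero_le _) hxy
      rw [this, measure_empty]
      exact zero_le
    · calc _ ≤ _ := clockLaw_avoid_succ_le x y n
        _ ≤ (K : ℝ≥0∞)⁻¹ * ∑ k, ENNReal.ofReal
            (barrier y (Equiv.swap k (k + 1) x) / (K : ℝ) ^ 2 * (1 - 1 / (K : ℝ) ^ 3) ^ n) := by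
            gcongr with k
            exact ih _
        _ = ENNReal.ofReal ((K : ℝ)⁻¹ * ∑ k,
            (barrier y (Equiv.swap k (k + 1) x) / (K : ℝ) ^ 2 * (1 - 1 / (K : ℝ) ^ 3) ^ n)) := by
            rw [ENNReal.ofReal_mul (by positivity), ENNReal.ofReal_inv_of_pos hK0,
              ENNReal.ofReal_natCast, ENNReal.ofReal_sum_of_nonneg]
            exact fun k _ => mul_nonneg (div_nonneg (hb _) (by positivity)) (pow_nonneg hr n)
        _ ≤ _ := by
            refine ENNReal.ofReal_le_ofReal ?_
            rw [← Finset.sum_mul, ← Finset.sum_div, sum_swap_apply hK,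
              barrier_add_one_add_barrier_sub_one hK hxy, pow_succ' _ n, ← mul_assoc, ← mul_assoc]
            refine mul_le_mul_of_nonneg_right ?_ (pow_nonneg hr n)
            have h2 := (barrier_bounds y x).2
            have h3 : barrier y x / (K : ℝ) ^ 2 ≤ 2 := by
              rwa [div_le_iff₀ (by positivity)]
            -- After division by `K ^ 2` the mean loss per ring is `2 / K ^ 3`. By `h3` this is at
            -- least the fraction `1 / K ^ 3` of the normalised barrier.
            have e1 : (K : ℝ)⁻¹ * ((K * barrier y x + (2 * barrier y x - 2 - 2 * barrier y x)) /
                (K : ℝ) ^ 2) = barrier y x / (K : ℝ) ^ 2 - 2 / (K : ℝ) ^ 3 := by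
              field_simp; ring
            have e2 : barrier y x / (K : ℝ) ^ 2 * (1 - 1 / (K : ℝ) ^ 3) =
                barrier y x / (K : ℝ) ^ 2 - barrier y x / (K : ℝ) ^ 2 / (K : ℝ) ^ 3 := by ring
            rw [e1, e2]
            gcongr

theorem clockLaw_avoid_le [NeZero K] (hK : 2 ≤ K) (x y : ZMod K) (n : ℕ) :
    clockLaw K (avoid x y n) ≤ ENNReal.ofReal (2 * Real.exp (-(n / (K : ℝ) ^ 3))) := by
  have hK2 : (2 : ℝ) ≤ K := by exact_mod_cast hK
  refine (clockLaw_avoid_le_barrier hK x y n).trans (ENNReal.ofReal_le_ofReal ?_)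
  have hr : 0 ≤ 1 - 1 / (K : ℝ) ^ 3 := by
    rw [sub_nonneg, div_le_one (by positivity)]
    exact one_le_pow₀ (by linarith)
  have h1 : barrier y x / (K : ℝ) ^ 2 ≤ 2 := by
    rw [div_le_iff₀ (by positivity)]
    exact (barrier_bounds y x).2
  have h2 : (1 - 1 / (K : ℝ) ^ 3) ^ n ≤ Real.exp (-(n / (K : ℝ) ^ 3)) := by
    calc _ ≤ Real.exp (-(1 / (K : ℝ) ^ 3)) ^ n :=
          pow_le_pow_left₀ hr (Real.one_sub_le_exp_neg _) n
      _ = _ := by rw [← Real.exp_nat_mul]; congr 1; ring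
  exact mul_le_mul h1 h2 (pow_nonneg hr n) zero_le_two

/-! ### The number of rings -/

/-- The mean is the integral of the tail `exp(-K t)` over `t > 0`. -/
theorem lintegral_expMeasure [NeZero K] :
    ∫⁻ s, ENNReal.ofReal s ∂expMeasure K = ENNReal.ofReal (1 / K) := by
  have hK : (0 : ℝ) < K := by exact_mod_cast Nat.pos_of_ne_zero (NeZero.ne K)
  have h0 : 0 ≤ᵐ[expMeasure (K : ℝ)] fun s => s := by
    have : expMeasure (K : ℝ) (Set.Iic 0) = 0 := by rw [expMeasure_Iic]; simp
    refine measure_mono_null (fun s hs => ?_) this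
    have hs' : ¬ (0 ≤ s) := hs
    exact (not_le.1 hs').le
  have htail : ∀ t ∈ Set.Ioi (0 : ℝ), expMeasure (K : ℝ) {a | t < a} =
      ENNReal.ofReal (Real.exp (-K * t)) := by
    intro t ht
    have ht' : (0 : ℝ) < t := ht
    have hc : {a : ℝ | t < a} = (Set.Iic t)ᶜ := by ext; simp
    have hexp : Real.exp (-(K * t)) ≤ 1 := Real.exp_le_one_iff.2 (by nlinarith)
    rw [hc, prob_compl_eq_one_sub measurableSet_Iic, expMeasure_Iic, if_pos ht'.le,
      ← ENNReal.ofReal_one, ← ENNReal.ofReal_sub _ (by linarith)]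
    congr 1
    rw [neg_mul]; ring
  rw [lintegral_eq_lintegral_meas_lt _ h0 aemeasurable_id, setLIntegral_congr_fun measurableSet_Ioi
    htail, ← ofReal_integral_eq_lintegral_ofReal (integrableOn_exp_mul_Ioi (by linarith) 0)
    (Eventually.of_forall fun _ => (Real.exp_pos _).le), integral_exp_mul_Ioi (by linarith)]
  simp

theorem lintegral_waitingTime [NeZero K] (i : ℕ) :
    ∫⁻ ω, ENNReal.ofReal (ω i).1 ∂clockLaw K = ENNReal.ofReal (1 / K) := by
  have h : MeasurePreserving (fun ω : ℕ → ℝ × ZMod K => (ω i).1) (clockLaw K) (expMeasure K) :=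
    measurePreserving_fst.comp (measurePreserving_eval_infinitePi
      (fun _ : ℕ => (expMeasure K).prod (uniformOn (Set.univ : Set (ZMod K)))) i)
  rw [← lintegral_expMeasure, ← h.lintegral_comp ENNReal.measurable_ofReal]

/-- With fewer than `n` rings up to `T`, the first `n` waiting times sum to more than `T`, while
their mean sum is `n / K`; Markov's inequality applies. -/
theorem clockLaw_ringCount_lt_le [NeZero K] {T : ℝ} (hT : 0 < T) (n : ℕ) :
    clockLaw K {ω | ringCount ω T < n} ≤ ENNReal.ofReal (n / (K * T)) := by
  have hK : (0 : ℝ) < K := by exact_mod_cast Nat.pos_of_ne_zero (NeZero.ne K)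
  have hm : ∀ i, Measurable fun ω : ℕ → ℝ × ZMod K => ENNReal.ofReal (ω i).1 := fun i =>
    ENNReal.measurable_ofReal.comp (measurable_fst.comp (measurable_pi_apply i))
  set S : (ℕ → ℝ × ZMod K) → ℝ≥0∞ := fun ω => ∑ i ∈ Finset.range n, ENNReal.ofReal (ω i).1 with hS
  have hsub : {ω : ℕ → ℝ × ZMod K | ringCount ω T < n} ≤ᵐ[clockLaw K]
      {ω | ENNReal.ofReal T ≤ S ω} := by
    filter_upwards [ae_exists_lt_ringTime (K := K)] with ω hω hn
    -- The almost sure unboundedness of the ring times excludes the default value `0` of `sInf` on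
    -- the empty set.
    have hlt : T < ringTime ω (ringCount ω T) := Nat.sInf_mem (s := {n | T < ringTime ω n}) (hω T)
    -- Rings are numbered from `0`, so `ringTime ω N` is a sum of `N + 1` waiting times.
    have hn' : ringCount ω T + 1 ≤ n := hn
    calc ENNReal.ofReal T ≤ ENNReal.ofReal (ringTime ω (ringCount ω T)) :=
          ENNReal.ofReal_le_ofReal hlt.le
      _ ≤ ∑ i ∈ Finset.range (ringCount ω T + 1), ENNReal.ofReal (ω i).1 := by
          unfold ringTime
          exact Finset.le_sum_of_subadditive _ ENNReal.ofReal_zero.le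
            (fun _ _ => ENNReal.ofReal_add_le) _ _
      _ ≤ S ω := Finset.sum_le_sum_of_subset (Finset.range_mono hn')
  calc _ ≤ _ := measure_mono_ae hsub
    _ ≤ (∫⁻ ω, S ω ∂clockLaw K) / ENNReal.ofReal T :=
        meas_ge_le_lintegral_div (Finset.measurable_fun_sum _ fun i _ => hm i).aemeasurable
          (by simpa using hT) ENNReal.ofReal_ne_top
    _ = _ := by
        rw [lintegral_finsetSum _ fun i _ => hm i]
        simp only [lintegral_waitingTime, Finset.sum_const, Finset.card_range, nsmul_eq_mul]
        rw [← ENNReal.ofReal_natCast n, ← ENNReal.ofReal_mul (by positivity),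
          ← ENNReal.ofReal_div_of_pos hT]
        congr 1
        field_simp

/-! ### The transience probability -/

/-- Either fewer than `n` rings have occurred, or some pair `x`, `y` is avoided for `n` rings. The
parameter `n` is free, to balance the two errors. -/
theorem maxTransienceProb_le [NeZero K] (hK : 2 ≤ K) {T : ℝ} (hT : 0 < T) (n : ℕ) :
    maxTransienceProb K T ≤ ENNReal.ofReal
      (n / (K * T) + (K : ℝ) ^ 2 * (2 * Real.exp (-(n / (K : ℝ) ^ 3)))) := by
  have hK0 : (0 : ℝ) < K := by exact_mod_cast Nat.pos_of_ne_zero (NeZero.ne K)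
  refine iSup_le fun ξ => ?_
  have hsub : {ω | process ξ T ω ∈ transient K} ⊆
      {ω | ringCount ω T < n} ∪ ⋃ x : ZMod K, ⋃ y : ZMod K, avoid x y n := by
    intro ω hω
    rcases lt_or_ge (ringCount ω T) n with h | h
    · exact Or.inl h
    · obtain ⟨x, y, hxy⟩ := exists_avoid_of_transient ξ ω _ hω
      exact Or.inr (Set.mem_iUnion₂.2 ⟨x, y, avoid_anti x y h hxy⟩)
  calc transienceProb ξ T ≤ _ := measure_mono hsub
    _ ≤ clockLaw K {ω | ringCount ω T < n} +
        ∑ x : ZMod K, ∑ y : ZMod K, clockLaw K (avoid x y n) := by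
        refine (measure_union_le _ _).trans (add_le_add le_rfl ?_)
        exact (measure_iUnion_fintype_le _ _).trans
          (Finset.sum_le_sum fun x _ => measure_iUnion_fintype_le _ _)
    _ ≤ ENNReal.ofReal (n / (K * T)) +
        ∑ x : ZMod K, ∑ y : ZMod K, ENNReal.ofReal (2 * Real.exp (-(n / (K : ℝ) ^ 3))) := by
        gcongr with x _ y _
        · exact clockLaw_ringCount_lt_le hT n
        · exact clockLaw_avoid_le hK x y n
    _ = _ := by
        rw [ENNReal.ofReal_add (by positivity) (by positivity),
          ENNReal.ofReal_mul (p := (K : ℝ) ^ 2) (by positivity)]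
        simp only [Finset.sum_const, Finset.card_univ, ZMod.card, nsmul_eq_mul]
        rw [ENNReal.ofReal_pow hK0.le, ENNReal.ofReal_natCast, ← mul_assoc, sq]

theorem maxTransienceProb_one (T : ℝ) : maxTransienceProb 1 T = 0 := by
  have h : transient 1 = ∅ := Set.eq_empty_of_forall_notMem fun ξ => by
    rintro ⟨⟨k, hk⟩, l, hl⟩
    rw [Subsingleton.elim k l] at hk
    omega
  simp [maxTransienceProb, transienceProb, h]

/-- Here `s` stands for `√t`. The bound does not depend on `K`, which gives the supremum over `K`.
-/
theorem maxTransienceProb_mul_log_le (hK : 1 ≤ K) {s : ℝ} (hs : 2 ≤ s) :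
    maxTransienceProb K (s ^ 2 * (K : ℝ) ^ 2 * Real.log K) ≤
      ENNReal.ofReal (2 / s + 2 * (2 : ℝ) ^ (2 - s)) := by
  rcases hK.eq_or_lt with rfl | hK
  · rw [maxTransienceProb_one]
    exact zero_le
  have : NeZero K := ⟨by omega⟩
  have hK2 : (2 : ℝ) ≤ K := by exact_mod_cast hK
  have hK0 : (0 : ℝ) < K := by linarith
  have hlog : 1 / 2 ≤ Real.log K :=
    (by linarith [Real.log_two_gt_d9] : (1 : ℝ) / 2 ≤ Real.log 2).trans
      (Real.log_le_log two_pos hK2)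
  have hlog0 : 0 < Real.log K := by linarith
  -- This is the fraction `1 / s` of the mean number of rings, yet `a / K ^ 3 = s log K` makes the
  -- exponential at most `K ^ (-s)`.
  set a : ℝ := s * (K : ℝ) ^ 3 * Real.log K with ha
  -- With `a ≥ 1`, rounding up at most doubles `a`; this is the `2` in `2 / s`.
  have ha1 : 1 ≤ a := by
    have h3 : (1 : ℝ) ≤ (K : ℝ) ^ 3 := one_le_pow₀ (by linarith)
    have : 2 * 1 * (1 / 2 : ℝ) ≤ a := by rw [ha]; gcongr
    linarith
  refine (maxTransienceProb_le hK (by positivity) ⌈a⌉₊).trans (ENNReal.ofReal_le_ofReal ?_)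
  have hn1 : a ≤ ⌈a⌉₊ := Nat.le_ceil a
  have hn2 : (⌈a⌉₊ : ℝ) ≤ 2 * a := by linarith [Nat.ceil_lt_add_one (by linarith : (0 : ℝ) ≤ a)]
  refine add_le_add ?_ ?_
  · rw [div_le_div_iff₀ (by positivity) (by positivity)]
    calc (⌈a⌉₊ : ℝ) * s ≤ 2 * a * s := by gcongr
      _ = _ := by rw [ha]; ring
  · have h1 : Real.exp (-(⌈a⌉₊ / (K : ℝ) ^ 3)) ≤ (K : ℝ) ^ (-s) := by
      rw [Real.rpow_def_of_pos hK0, Real.exp_le_exp]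
      have : s * Real.log K ≤ ⌈a⌉₊ / (K : ℝ) ^ 3 := by
        rw [le_div_iff₀ (by positivity)]
        calc _ = a := by rw [ha]; ring
          _ ≤ _ := hn1
      linarith
    calc _ ≤ (K : ℝ) ^ 2 * (2 * (K : ℝ) ^ (-s)) := by gcongr
      _ = 2 * (K : ℝ) ^ (2 - s) := by
          rw [sub_eq_add_neg, Real.rpow_add hK0, Real.rpow_two]; ring
      _ ≤ 2 * (2 : ℝ) ^ (2 - s) := by
          gcongr 2 * ?_
          -- Since `s ≥ 2` the exponent is nonpositive, so `K = 2` is the worst case.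
          exact Real.rpow_le_rpow_of_nonpos two_pos hK2 (by linarith)

end SWT

theorem theorem1p1 :
    Tendsto (fun t : ℝ =>
        ⨆ K : ℕ+, SWT.maxTransienceProb K (t * (K : ℝ) ^ 2 * Real.log (K : ℝ)))
      atTop (𝓝 0) := by
  have hlim : Tendsto (fun t : ℝ => ENNReal.ofReal (2 / √t + 2 * (2 : ℝ) ^ (2 - √t)))
      atTop (𝓝 0) := by
    have hsqrt := Real.tendsto_sqrt_atTop
    have h1 : Tendsto (fun s : ℝ => 2 / s) atTop (𝓝 0) := tendsto_id.const_div_atTop 2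
    have h2 : Tendsto (fun s : ℝ => (2 : ℝ) ^ (2 - s)) atTop (𝓝 0) :=
      (tendsto_rpow_atBot_of_base_gt_one 2 one_lt_two).comp
        (tendsto_atBot_add_const_left _ 2 tendsto_neg_atTop_atBot)
    have h3 := (h1.add (h2.const_mul 2)).comp hsqrt
    rw [mul_zero, add_zero] at h3
    simpa using ENNReal.tendsto_ofReal h3
  refine tendsto_of_tendsto_of_tendsto_of_le_of_le' tendsto_const_nhds hlim
    (Eventually.of_forall fun _ => zero_le) ?_
  -- The threshold `4` ensures `√t ≥ 2`.
  filter_upwards [eventually_ge_atTop 4] with t ht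
  refine iSup_le fun K => ?_
  have hs : 2 ≤ √t := Real.le_sqrt_of_sq_le (by linarith)
  have h := SWT.maxTransienceProb_mul_log_le K.pos hs
  rwa [Real.sq_sqrt (by linarith)] at h
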